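/- Let $k\ge 1$, let $\mathcal X=\{x\in\mathbb R^k:\|x\|\le \tfrac12\}$ with the Euclidean distance $d$ and the uniform distribution, and let $\mathcal C_{\mathrm{HHS}}=\{\,\mathbb 1\{\langle\omega,x\rangle\ge 0\} : \omega\in\mathbb R^k\}$ be the class of homogeneous half-spaces on $\mathcal X$; $\mathrm{err}(C,\ell)$ is the probability that $C(x)\ne\ell(x)$ for uniform $x\in\mathcal X$. Let $c>0$ and let $f:[0,\infty)\to[0,\infty)$ be non-decreasing with $f(x)\le x^{1+c}$ for all $x$ and $f(x)>0$ for $x>0$. For a target $\ell$ and $x\in\mathcal X$, let $\mathrm{CE}_{\min}(x)$ be the set of points closest to $x$ among all limits in $\mathcal X$ of sequences of points whose label differs from $\ell(x)$. In each step an active learner, which may randomize, chooses $x\in\mathcal X$ (depending on all previous examples) and receives $(x,\ell(x))$ and a contrastive example $(x',\ell(x'))$. In the deterministic approximate minimum distance model $\mathrm{CE}_{\mathrm{app}}^{d,f}$, $x'$ is any point, adversarially chosen, with $\ell(x')\neq\ell(x)$ and $d(x',z)\le f(d(x,z))$ for some $z\in \mathrm{CE}_{\min}(x)$. In the probabilistic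 model $\mathrm{CE}_{\mathrm{prob}}^{d,f}$, $x'$ is sampled independently from a distribution $\mathcal D_x$ (unknown to the learner) on points with $\ell(x')\ne\ell(x)$ such that $\mathbb E_{x'\sim\mathcal D_x}[d(x',z)]\le f(d(x,z))$ for some $z\in\mathrm{CE}_{\min}(x)$. If no admissible $x'$ (resp. $\mathcal D_x$) exists for a queried $x$, as when $x$ lies on the decision boundary, the point $x'$ (resp. the distribution $\mathcal D_x$) is arbitrary. For a learner $\mathcal A$ and a model $\mathrm{CE}$, let $\mathcal M_{\Pr}[\mathcal C_{\mathrm{HHS}},\mathrm{CE},\mathcal A](\varepsilon,\delta)$ be the least $m^*\in\{0,1,2,\dots\}$ such that for every $\ell\in\mathcal C_{\mathrm{HHS}}$, every oracle behaviour that the model allows and every $m\ge m^*$, the hypothesis from $\mathcal C_{\mathrm{HHS}}$ that $\mathcal A$ outputs after $m$ steps satisfies $\Pr[\mathrm{err}>\varepsilon]<\delta$ ($\infty$ if there is none), and let $\mathcal M_{\Pr,\mathrm{act}}[\mathcal C_{\mathrm{HHS}},\mathrm{CE}](\varepsilon,\delta)$ be the infimum over all active learners. Then for all $\varepsilon,\delta\in(0,1]$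 $$\mathcal M_{\Pr,\mathrm{act}}[\mathcal C_{\mathrm{HHS}},\mathrm{CE}_{\mathrm{app}}^{d,f}](\varepsilon,\delta)=\mathcal M_{\Pr,\mathrm{act}}[\mathcal C_{\mathrm{HHS}},\mathrm{CE}_{\mathrm{prob}}^{d,f}](\varepsilon,\delta)\le 1 .$$ Both quantities are equal to $1$ whenever $\varepsilon<\tfrac12$ and $\delta\le\tfrac23$. Moreover, if $\varepsilon<\tfrac12$ and $\delta\in(0,1]$ is arbitrary, then every learner that does not randomize has sample complexity at least $1$ in both models. -/

import Mathlib

open MeasureTheory ProbabilityTheory Filter Topology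
open scoped NNReal ENNReal

noncomputable section

namespace ContrastiveLearning

section General

variable {X : Type} [MetricSpace X] [MeasureSpace X]

/-- The label that the concept `ℓ` gives to `x`; a concept is identified with its indicator. -/
def label (ℓ : Set X) (x : X) : Bool :=
  open Classical in decide (x ∈ ℓ)

/-- The uniform distribution on the instance space: normalized volume. -/
def uniform (X : Type) [MeasureSpace X] : Measure X :=
  (volume : Measure X)[|Set.univ]

/-- The error of `C` with respect to `ℓ`: the uniform probability that the labels disagree. -/
def err (C ℓ : Set X) : ℝ :=
  (uniform X).real {x | label ℓ x ≠ label C x}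

/-- The limits, in `X`, of sequences of points whose label differs from that of `x`. -/
def oppositeLimits (ℓ : Set X) (x : X) : Set X :=
  {x' | ∃ u : ℕ → X, (∀ i, label ℓ (u i) ≠ label ℓ x) ∧ Tendsto u atTop (𝓝 x')}

/-- The ideal contrastive examples for `x` (minimum distance mechanism). -/
def CEmin (ℓ : Set X) (x : X) : Set X :=
  {x' ∈ oppositeLimits ℓ x | ∀ y ∈ oppositeLimits ℓ x, dist x x' ≤ dist x y}

/-- The contrastive examples allowed for `x` by the deterministic approximate minimum distance
model with noise function `f`. -/
def CEapp (f : ℝ≥0 → ℝ≥0) (ℓ : Set X) (x : X) : Set X :=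
  {x' | (∃ z ∈ CEmin ℓ x, nndist x' z ≤ f (nndist x z)) ∧ label ℓ x' ≠ label ℓ x}

/-- The distributions of contrastive examples allowed for `x` by the probabilistic approximate
minimum distance model: the label differs from that of `x`, and the expected distance to some
ideal contrastive example is bounded through `f`. -/
def CEprob (f : ℝ≥0 → ℝ≥0) (ℓ : Set X) (x : X) : Set (Measure X) :=
  {ν | IsProbabilityMeasure ν ∧ (∀ᵐ y ∂ν, label ℓ y ≠ label ℓ x) ∧
    ∃ z ∈ CEmin ℓ x, ∫⁻ y, edist y z ∂ν ≤ (f (nndist x z) : ℝ≥0∞)}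

/-- A labeled primary example together with its labeled contrastive example. -/
abbrev ExamplePair (X : Type) : Type := (X × Bool) × (X × Bool)

/-- A (contrastive) oracle: the distribution of the contrastive instance in step `n`, given the
`n` example pairs seen so far and the current primary instance. -/
structure Oracle (X : Type) [MeasurableSpace X] where
  resp : ∀ n : ℕ, Kernel ((Fin n → ExamplePair X) × X) X
  markov : ∀ n, IsMarkovKernel (resp n)

/-- The oracles of the deterministic model for the target `ℓ`. In every step the oracle picks,
adversarially and possibly depending on the past, an arbitrary allowed contrastive example.
If a primary example has no allowed contrastive example at all, then the answer is an arbitrary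
point (so that such a query never helps the learner). -/
def appOracles (f : ℝ≥0 → ℝ≥0) (ℓ : Set X) : Set (Oracle X) :=
  {O | ∃ g : ∀ n : ℕ, (Fin n → ExamplePair X) × X → X,
    (∀ n, Measurable (g n)) ∧
    (∀ n h x, (CEapp f ℓ x).Nonempty → g n (h, x) ∈ CEapp f ℓ x) ∧
    ∀ n p, O.resp n p = Measure.dirac (g n p)}

/-- The oracles of the probabilistic model for the target `ℓ`. There is one distribution `D x`
for each instance `x`, allowed whenever `x` has an allowed distribution at all and arbitrary
otherwise, and each answer is a fresh sample of `D x`. -/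
def probOracles (f : ℝ≥0 → ℝ≥0) (ℓ : Set X) : Set (Oracle X) :=
  {O | ∃ D : Kernel X X,
    (∀ x, (CEprob f ℓ x).Nonempty → D x ∈ CEprob f ℓ x) ∧
    ∀ n p, O.resp n p = D p.2}

/-- An adaptive active learner for the class `𝒞`. It may use a private random seed. In step `n`
it chooses the primary instance from the `n` pairs seen so far, and after `n` steps
it can output a hypothesis, which belongs to `𝒞`. -/
structure ActiveLearner (X : Type) [MeasurableSpace X] (𝒞 : Set (Set X)) where
  Seed : Type
  [measurableSpaceSeed : MeasurableSpace Seed]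
  seedLaw : Measure Seed
  isProbabilityMeasure_seedLaw : IsProbabilityMeasure seedLaw
  query : ∀ n : ℕ, Seed × (Fin n → ExamplePair X) → X
  measurable_query : ∀ n, Measurable (query n)
  output : ∀ n : ℕ, Seed × (Fin n → ExamplePair X) → Set X
  output_mem : ∀ n p, output n p ∈ 𝒞

attribute [instance] ActiveLearner.measurableSpaceSeed

variable {𝒞 : Set (Set X)}

/-- A learner is deterministic if there is only one seed. -/
def ActiveLearner.IsDeterministic (A : ActiveLearner X 𝒞) : Prop :=
  Subsingleton A.Seed

/-- The joint law of the seed and of the first `n` example pairs, when the learner `A` interacts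
with the oracle `O` and the target (a measurable set) is `ℓ`. -/
def interactionLaw (A : ActiveLearner X 𝒞) (ℓ : Set X) (O : Oracle X) :
    ∀ n : ℕ, Measure (A.Seed × (Fin n → ExamplePair X))
  | 0 => A.seedLaw.map fun s => (s, Fin.elim0)
  | n + 1 =>
    (interactionLaw A ℓ O n ⊗ₘ
      (O.resp n).comap (fun p : A.Seed × (Fin n → ExamplePair X) => (p.2, A.query n p))
        (measurable_snd.prodMk (A.measurable_query n))).map
      fun q => (q.1.1, Fin.snoc (α := fun _ => ExamplePair X) q.1.2
        ((A.query n q.1, label ℓ (A.query n q.1)), (q.2, label ℓ q.2)))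

/-- After `m` steps `A` meets the accuracy `ε` with confidence parameter `δ`, for the target `ℓ`
and the oracle `O`. (For a non-measurable event this is a bound on its outer measure.) -/
def Succeeds (A : ActiveLearner X 𝒞) (ℓ : Set X) (O : Oracle X) (ε δ : ℝ) (m : ℕ) : Prop :=
  interactionLaw A ℓ O m {p | ε < err (A.output m p) ℓ} < ENNReal.ofReal δ

/-- The contrastive sample complexity of the learner `A`, for a mechanism that is given by its
set of possible oracles for each target: the least `m'` such that `A` succeeds
for each target in the class, each oracle, and each `m ≥ m'` (`⊤` if there is none). -/
def sampleComplexity (CE : Set X → Set (Oracle X)) (A : ActiveLearner X 𝒞) (ε δ : ℝ) : ℕ∞ :=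
  sInf {N : ℕ∞ | ∃ m' : ℕ, N = m' ∧
    ∀ ℓ ∈ 𝒞, ∀ O ∈ CE ℓ, ∀ m, m' ≤ m → Succeeds A ℓ O ε δ m}

/-- The active contrastive sample complexity of the class `𝒞`. -/
def activeSampleComplexity (𝒞 : Set (Set X)) (CE : Set X → Set (Oracle X)) (ε δ : ℝ) : ℕ∞ :=
  ⨅ A : ActiveLearner X 𝒞, sampleComplexity CE A ε δ

end General

/-- The closed Euclidean ball of radius `1/2` around the origin of `ℝ^k`. -/
abbrev Ball (k : ℕ) : Type := Metric.closedBall (0 : EuclideanSpace ℝ (Fin k)) (1 / 2)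

/-- The Lebesgue measure on the ball. -/
instance (k : ℕ) : MeasureSpace (Ball k) := Measure.Subtype.measureSpace

/-- Homogeneous half-spaces on the ball. -/
def HHS (k : ℕ) : Set (Set (Ball k)) :=
  {C | ∃ w : EuclideanSpace ℝ (Fin k), 
    C = {x : Ball k | 0 ≤ inner ℝ w (x : EuclideanSpace ℝ (Fin k))}}

end ContrastiveLearning

end

noncomputable section

namespace ContrastiveLearning

/-! ### Laws of the interaction and vanishing of the sample complexity. -/

section Interaction

variable {X : Type}

/-! For a unit normal `w`, the ideal contrastive example of `x` is its orthogonal projection `z` to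
the hyperplane (`CEmin_halfSpace`), so `x - z` is `w` scaled by `⟪w, x⟫`. One exact answer would
thus reveal the target. A noisy answer is off by about `d ^ (1 + c)`, where `d = |⟪w, x⟫|`; relative
to `d` this is `d ^ c`, which is small when `x` is close to the origin. Querying a random point of a
tiny ball makes `d` small and almost surely nonzero, whatever `w` is. Markov's inequality
(`measure_far_le`) bounds the probability of a large relative error, and a small relative error
changes labels only on a thin slab around the hyperplane (`err_halfSpace_le`,
`exists_uniform_slab_le`). The whole ball as target is recognized by equal labels in the pair. A
deterministic answer is a Dirac measure, so one argument serves both models and bounds both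
complexities by 1.

The complexities agree because each is 0 exactly when some learner succeeds before seeing any
example, a condition that does not involve the oracle (`activeSampleComplexity_eq_zero_iff`).

For the lower bound, every hypothesis is bad for at least two of the three targets given by the
whole ball and two opposite half-spaces (`lt_err_hardTarget`). Hence some target has failure
probability at least `2 / 3` at step 0, and a constant output fails surely for some target. The
lower bounds also need oracles to exist, which takes a measurable choice of admissible answers
(`exists_measurable_contrast`). -/

theorem label_eq_label_iff {ℓ ℓ' : Set X} {x y : X} :
    label ℓ x = label ℓ' y ↔ (x ∈ ℓ ↔ y ∈ ℓ') := by
  simp [label]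

theorem label_eq_true_iff {ℓ : Set X} {x : X} : label ℓ x = true ↔ x ∈ ℓ := by
  simp [label]

theorem measurable_label [MeasureSpace X] {ℓ : Set X} (hℓ : MeasurableSet ℓ) : Measurable (label ℓ) := by
  refine measurable_to_bool ?_
  convert hℓ using 1
  ext x
  simp [label]

variable [MeasureSpace X] {𝒞 : Set (Set X)}

attribute [instance] ActiveLearner.isProbabilityMeasure_seedLaw Oracle.markov

theorem measurable_snoc_examplePair (A : ActiveLearner X 𝒞) {ℓ : Set X} (hℓ : MeasurableSet ℓ)
    (n : ℕ) : Measurable fun q : (A.Seed × (Fin n → ExamplePair X)) × X =>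
      (q.1.1, Fin.snoc (α := fun _ => ExamplePair X) q.1.2
        ((A.query n q.1, label ℓ (A.query n q.1)), (q.2, label ℓ q.2))) := by
  have hq := A.measurable_query n
  have hl := measurable_label hℓ
  refine (measurable_fst.comp measurable_fst).prodMk (measurable_pi_iff.2 fun i => ?_)
  induction i using Fin.lastCases with
  | last => simp only [Fin.snoc_last]; fun_prop
  | cast i => simp only [Fin.snoc_castSucc]; fun_prop

theorem isProbabilityMeasure_interactionLaw (A : ActiveLearner X 𝒞) {ℓ : Set X}
    (hℓ : MeasurableSet ℓ) (O : Oracle X) (n : ℕ) :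
    IsProbabilityMeasure (interactionLaw A ℓ O n) := by
  induction n with
  | zero =>
    exact Measure.isProbabilityMeasure_map (by fun_prop)
  | succ n ih =>
    exact Measure.isProbabilityMeasure_map (measurable_snoc_examplePair A hℓ n).aemeasurable

/-- Forgetting the last example pair. -/
theorem interactionLaw_succ_map_init (A : ActiveLearner X 𝒞) {ℓ : Set X}
    (hℓ : MeasurableSet ℓ) (O : Oracle X) (n : ℕ) :
    (interactionLaw A ℓ O (n + 1)).map
      (fun p => (p.1, fun i : Fin n => p.2 i.castSucc)) = interactionLaw A ℓ O n := by
  have := isProbabilityMeasure_interactionLaw A hℓ O n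
  have h := Measure.fst_compProd (interactionLaw A ℓ O n)
    ((O.resp n).comap (fun p : A.Seed × (Fin n → ExamplePair X) => (p.2, A.query n p))
      (measurable_snd.prodMk (A.measurable_query n)))
  rw [interactionLaw, Measure.map_map (by fun_prop) (measurable_snoc_examplePair A hℓ n)]
  conv_rhs => rw [← h, Measure.fst]
  congr 1
  funext q
  simp only [Function.comp, Fin.snoc_castSucc]

theorem interactionLaw_map_fst (A : ActiveLearner X 𝒞) {ℓ : Set X}
    (hℓ : MeasurableSet ℓ) (O : Oracle X) (n : ℕ) :
    (interactionLaw A ℓ O n).map Prod.fst = A.seedLaw := by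
  induction n with
  | zero =>
    rw [interactionLaw, Measure.map_map (by fun_prop) (by fun_prop)]
    exact Measure.map_id
  | succ n ih =>
    rw [← ih, ← interactionLaw_succ_map_init A hℓ O n,
      Measure.map_map (by fun_prop) (by fun_prop)]
    rfl

/-- The law of the seed and of the first example pair does not change after the first step. -/
theorem interactionLaw_map_first (A : ActiveLearner X 𝒞) {ℓ : Set X}
    (hℓ : MeasurableSet ℓ) (O : Oracle X) (n : ℕ) :
    (interactionLaw A ℓ O (n + 1)).map (fun p => (p.1, p.2 0)) =
      (interactionLaw A ℓ O 1).map (fun p => (p.1, p.2 0)) := by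
  induction n with
  | zero => rfl
  | succ n ih =>
    rw [← ih, ← interactionLaw_succ_map_init A hℓ O (n + 1),
      Measure.map_map (by fun_prop) (by fun_prop)]
    rfl

/-- Reduces an event about the seed and first pair, at any later time, to a bound on the first
answer conditional on the seed. -/
theorem interactionLaw_first_le (A : ActiveLearner X 𝒞) {ℓ : Set X}
    (hℓ : MeasurableSet ℓ) (O : Oracle X) (n : ℕ) {S : Set (A.Seed × ExamplePair X)}
    (hS : MeasurableSet S) {η : ℝ≥0∞}
    (h : ∀ᵐ s ∂A.seedLaw, O.resp 0 (Fin.elim0, A.query 0 (s, Fin.elim0))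
      {y | (s, ((A.query 0 (s, Fin.elim0), label ℓ (A.query 0 (s, Fin.elim0))),
        (y, label ℓ y))) ∈ S} ≤ η) :
    interactionLaw A ℓ O (n + 1) {p | (p.1, p.2 0) ∈ S} ≤ η := by
  have h0 := isProbabilityMeasure_interactionLaw A hℓ O 0
  have hm : Measurable fun s : A.Seed =>
      ((s, Fin.elim0) : A.Seed × (Fin 0 → ExamplePair X)) := by fun_prop
  have hF := measurable_snoc_examplePair A hℓ 0
  have hfirst : ∀ m : ℕ, Measurable fun p : A.Seed × (Fin (m + 1) → ExamplePair X) =>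
      (p.1, p.2 0) := fun m => by fun_prop
  change interactionLaw A ℓ O (n + 1) ((fun p => (p.1, p.2 0)) ⁻¹' S) ≤ η
  rw [← Measure.map_apply (hfirst n) hS, interactionLaw_map_first A hℓ,
    Measure.map_apply (hfirst 0) hS]
  rw [interactionLaw, Measure.map_apply hF (hfirst 0 hS),
    Measure.compProd_apply (hF (hfirst 0 hS)), interactionLaw, lintegral_map _ hm]
  · calc _ ≤ ∫⁻ _, η ∂A.seedLaw := by
          refine lintegral_mono_ae ?_
          filter_upwards [h] with s hs
          exact hs
      _ = η := by simp
  · exact Kernel.measurable_kernel_prodMk_left (hF (hfirst 0 hS))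

theorem sampleComplexity_eq_zero_iff {CE : Set X → Set (Oracle X)} {A : ActiveLearner X 𝒞}
    {ε δ : ℝ} : sampleComplexity CE A ε δ = 0 ↔
      ∀ ℓ ∈ 𝒞, ∀ O ∈ CE ℓ, ∀ m, Succeeds A ℓ O ε δ m := by
  constructor
  · intro h
    have hne : {N : ℕ∞ | ∃ m' : ℕ, N = m' ∧
        ∀ ℓ ∈ 𝒞, ∀ O ∈ CE ℓ, ∀ m, m' ≤ m → Succeeds A ℓ O ε δ m}.Nonempty := by
      rw [Set.nonempty_iff_ne_empty]
      intro he
      rw [sampleComplexity, he, sInf_empty] at h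
      exact absurd h (by simp)
    obtain ⟨m', hm', H⟩ := csInf_mem hne
    rw [sampleComplexity] at h
    rw [h] at hm'
    have : m' = 0 := by exact_mod_cast hm'.symm
    exact fun ℓ hℓ O hO m => H ℓ hℓ O hO m (by omega)
  · intro h
    exact le_antisymm (sInf_le ⟨0, rfl, fun ℓ hℓ O hO m _ => h ℓ hℓ O hO m⟩) bot_le

theorem sampleComplexity_le_one {CE : Set X → Set (Oracle X)} {A : ActiveLearner X 𝒞}
    {ε δ : ℝ} (h : ∀ ℓ ∈ 𝒞, ∀ O ∈ CE ℓ, ∀ m, Succeeds A ℓ O ε δ (m + 1)) :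
    sampleComplexity CE A ε δ ≤ 1 := by
  refine sInf_le ⟨1, rfl, fun ℓ hℓ O hO m hm => ?_⟩
  obtain ⟨m, rfl⟩ := Nat.exists_eq_add_of_le' hm
  exact h ℓ hℓ O hO m

/-- The learner that ignores all examples and always outputs the initial hypothesis of `A`. -/
def ActiveLearner.freeze (A : ActiveLearner X 𝒞) : ActiveLearner X 𝒞 where
  Seed := A.Seed
  seedLaw := A.seedLaw
  isProbabilityMeasure_seedLaw := A.isProbabilityMeasure_seedLaw
  query := A.query
  measurable_query := A.measurable_query
  output _ p := A.output 0 (p.1, Fin.elim0)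
  output_mem _ _ := A.output_mem 0 _

/-- The frozen output depends on the seed alone, and the law of the seed is the same at every step
and for every oracle. -/
theorem succeeds_freeze {A : ActiveLearner X 𝒞} {ℓ : Set X} (hℓ : MeasurableSet ℓ)
    {O : Oracle X} {ε δ : ℝ} (h : Succeeds A ℓ O ε δ 0) (O' : Oracle X) (m : ℕ) :
    Succeeds A.freeze ℓ O' ε δ m := by
  have hm : Measurable fun s : A.Seed =>
      ((s, Fin.elim0) : A.Seed × (Fin 0 → ExamplePair X)) := by fun_prop
  -- Outputs need not be measurable, so the failure event is replaced by a measurable hull of equal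
  -- measure before it is transported.
  set T := toMeasurable (interactionLaw A ℓ O 0) {p | ε < err (A.output 0 p) ℓ} with hT
  have hTm : MeasurableSet T := measurableSet_toMeasurable _ _
  have hTs : {p | ε < err (A.output 0 p) ℓ} ⊆ T := subset_toMeasurable _ _
  have hlt : A.seedLaw ((fun s => (s, Fin.elim0)) ⁻¹' T) < ENNReal.ofReal δ := by
    rw [← Measure.map_apply hm hTm]
    change interactionLaw A ℓ O 0 T < _
    rw [hT, measure_toMeasurable]
    exact h
  refine lt_of_le_of_lt ?_ hlt
  have := interactionLaw_map_fst A.freeze hℓ O' m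
  have hE : MeasurableSet[A.freeze.measurableSpaceSeed]
      ((fun s : A.freeze.Seed => ((s, Fin.elim0) : A.Seed × (Fin 0 → ExamplePair X))) ⁻¹' T) :=
    hm hTm
  rw [Measure.ext_iff] at this
  have h' := (Measure.map_apply measurable_fst hE).symm.trans (this _ hE)
  refine le_trans (measure_mono ?_) h'.le
  exact fun p hp => hTs hp

/-- Complexity 0 demands success at all steps, not only at step 0; freezing the initial hypothesis
closes this gap. The right side does not depend on `CE`, which is what allows two models to be
compared. -/
theorem activeSampleComplexity_eq_zero_iff {CE : Set X → Set (Oracle X)}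
    (hmeas : ∀ ℓ ∈ 𝒞, MeasurableSet ℓ) (hne : ∀ ℓ ∈ 𝒞, (CE ℓ).Nonempty) {ε δ : ℝ} :
    activeSampleComplexity 𝒞 CE ε δ = 0 ↔
      ∃ A : ActiveLearner X 𝒞, ∀ ℓ ∈ 𝒞, ∀ O, Succeeds A ℓ O ε δ 0 := by
  constructor
  · intro h
    have : Nonempty (ActiveLearner X 𝒞) := by
      by_contra hc
      rw [not_nonempty_iff] at hc
      rw [activeSampleComplexity, iInf_of_empty] at h
      exact absurd h (by simp)
    obtain ⟨A, hA⟩ := ciInf_mem fun A : ActiveLearner X 𝒞 => sampleComplexity CE A ε δ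
    refine ⟨A, fun ℓ hℓ O => ?_⟩
    obtain ⟨O', hO'⟩ := hne ℓ hℓ
    exact sampleComplexity_eq_zero_iff.1 (hA.trans h) ℓ hℓ O' hO' 0
  · rintro ⟨A, hA⟩
    refine le_antisymm (iInf_le_of_le A.freeze (le_of_eq ?_)) bot_le
    rw [sampleComplexity_eq_zero_iff]
    intro ℓ hℓ O hO m
    exact succeeds_freeze (hmeas ℓ hℓ) (hA ℓ hℓ O) O m

end Interaction

/-! ### Ideal and admissible contrastive examples for half-spaces. -/

section Geometry

variable {k : ℕ}

/-- The homogeneous half-space with normal vector `w`. -/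
def halfSpace (w : EuclideanSpace ℝ (Fin k)) : Set (Ball k) :=
  {x | 0 ≤ inner ℝ w (x : EuclideanSpace ℝ (Fin k))}

theorem mem_halfSpace {w : EuclideanSpace ℝ (Fin k)} {x : Ball k} :
    x ∈ halfSpace w ↔ 0 ≤ inner ℝ w (x : EuclideanSpace ℝ (Fin k)) := Iff.rfl

theorem halfSpace_mem_HHS (w : EuclideanSpace ℝ (Fin k)) : halfSpace w ∈ HHS k := ⟨w, rfl⟩

theorem halfSpace_zero : halfSpace (0 : EuclideanSpace ℝ (Fin k)) = Set.univ := by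
  ext x; simp [mem_halfSpace]

theorem univ_mem_HHS : (Set.univ : Set (Ball k)) ∈ HHS k :=
  halfSpace_zero (k := k) ▸ halfSpace_mem_HHS 0

theorem measurableSet_halfSpace (w : EuclideanSpace ℝ (Fin k)) :
    MeasurableSet (halfSpace w) := by
  have : Measurable fun x : Ball k => inner ℝ w (x : EuclideanSpace ℝ (Fin k)) := by
    fun_prop
  exact this measurableSet_Ici

theorem halfSpace_smul {a : ℝ} (ha : 0 < a) (w : EuclideanSpace ℝ (Fin k)) :
    halfSpace (a • w) = halfSpace w := by
  ext x
  simp [mem_halfSpace, inner_smul_left, ha]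

theorem mem_HHS_iff {ℓ : Set (Ball k)} :
    ℓ ∈ HHS k ↔ ℓ = Set.univ ∨ ∃ w : EuclideanSpace ℝ (Fin k), ‖w‖ = 1 ∧ ℓ = halfSpace w := by
  constructor
  · rintro ⟨w, rfl⟩
    change halfSpace w = _ ∨ ∃ w', _ ∧ halfSpace w = _
    by_cases hw : w = 0
    · exact .inl (hw ▸ halfSpace_zero)
    · refine .inr ⟨‖w‖⁻¹ • w, ?_, (halfSpace_smul (by positivity) w).symm⟩
      rw [norm_smul, norm_inv, norm_norm, inv_mul_cancel₀ (by simpa using hw)]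
  · rintro (rfl | ⟨w, -, rfl⟩)
    exacts [univ_mem_HHS, halfSpace_mem_HHS w]

theorem measurableSet_of_mem_HHS {ℓ : Set (Ball k)} (h : ℓ ∈ HHS k) : MeasurableSet ℓ := by
  obtain ⟨w, rfl⟩ := h
  exact measurableSet_halfSpace w

theorem norm_ball_le (x : Ball k) : ‖(x : EuclideanSpace ℝ (Fin k))‖ ≤ 1 / 2 := by
  simpa using x.2

theorem CEmin_univ (x : Ball k) : CEmin Set.univ x = ∅ := by
  ext z
  simp [CEmin, oppositeLimits, label]

theorem CEprob_univ (f : ℝ≥0 → ℝ≥0) (x : Ball k) : CEprob f Set.univ x = ∅ := by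
  ext z
  simp [CEprob, CEmin_univ]

theorem dirac_mem_CEprob {f : ℝ≥0 → ℝ≥0} {ℓ : Set (Ball k)} {x y : Ball k}
    (h : y ∈ CEapp f ℓ x) : Measure.dirac y ∈ CEprob f ℓ x := by
  obtain ⟨⟨z, hz, hd⟩, hl⟩ := h
  refine ⟨inferInstance, ?_, z, hz, ?_⟩
  · rw [ae_dirac_eq]
    exact hl
  · rw [lintegral_dirac, edist_nndist]
    exact_mod_cast hd

variable {w : EuclideanSpace ℝ (Fin k)}

theorem norm_sub_inner_smul_sq (hw : ‖w‖ = 1) (x : EuclideanSpace ℝ (Fin k)) (t : ℝ) :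
    ‖x - t • w‖ ^ 2 = ‖x‖ ^ 2 - 2 * t * inner ℝ w x + t ^ 2 := by
  rw [norm_sub_sq_real, inner_smul_right, norm_smul, hw, real_inner_comm]
  simp; ring

/-- Moving `x` against the normal vector by `t` between `0` and `2 ⟪w, x⟫` stays in the ball. -/
theorem sub_smul_mem_ball (hw : ‖w‖ = 1) (x : Ball k) {t : ℝ}
    (ht : t ^ 2 ≤ 2 * t * inner ℝ w (x : EuclideanSpace ℝ (Fin k))) :
    (x : EuclideanSpace ℝ (Fin k)) - t • w ∈
      Metric.closedBall (0 : EuclideanSpace ℝ (Fin k)) (1 / 2) := by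
  rw [mem_closedBall_zero_iff]
  refine le_trans ?_ (norm_ball_le x)
  rw [← sq_le_sq₀ (norm_nonneg _) (norm_nonneg _), norm_sub_inner_smul_sq hw]
  linarith

/-- The orthogonal projection of a point of the ball to the boundary of `halfSpace w`. -/
def boundaryProj (hw : ‖w‖ = 1) (x : Ball k) : Ball k :=
  ⟨(x : EuclideanSpace ℝ (Fin k)) - inner ℝ w (x : EuclideanSpace ℝ (Fin k)) • w,
    sub_smul_mem_ball hw x (by nlinarith [sq_nonneg (inner ℝ w (x : EuclideanSpace ℝ (Fin k)))])⟩

theorem inner_boundaryProj (hw : ‖w‖ = 1) (x : Ball k) :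
    inner ℝ w (boundaryProj hw x : EuclideanSpace ℝ (Fin k)) = 0 := by
  simp [boundaryProj, inner_sub_right, inner_smul_right, hw]

theorem dist_boundaryProj (hw : ‖w‖ = 1) (x : Ball k) :
    dist x (boundaryProj hw x) = |inner ℝ w (x : EuclideanSpace ℝ (Fin k))| := by
  rw [Subtype.dist_eq, dist_eq_norm]
  simp [boundaryProj, norm_smul, hw]

/-- The half-space is closed, so the two sides differ: for a positive `x` the point `z` is
approached along the segment from `-w / 2`, while for a negative `x` the point `z` itself has the
opposite label. -/
theorem mem_oppositeLimits_of_inner_eq_zero (hw : ‖w‖ = 1) (x : Ball k) {z : Ball k}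
    (hz : inner ℝ w (z : EuclideanSpace ℝ (Fin k)) = 0) :
    z ∈ oppositeLimits (halfSpace w) x := by
  by_cases hx : x ∈ halfSpace w
  · have hmem : -((1 / 2 : ℝ) • w) ∈
        Metric.closedBall (0 : EuclideanSpace ℝ (Fin k)) (1 / 2) := by
      simp [norm_smul, hw]
    have hconv := convex_closedBall (0 : EuclideanSpace ℝ (Fin k)) (1 / 2)
    have ht : ∀ n : ℕ, (0 : ℝ) < 1 / ((n : ℝ) + 1) := fun n => Nat.one_div_pos_of_nat
    have ht1 : ∀ n : ℕ, 1 / ((n : ℝ) + 1) ≤ 1 := fun n => by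
      rw [div_le_one (by positivity)]; linarith [n.cast_nonneg (α := ℝ)]
    refine ⟨fun n => ⟨(1 - 1 / ((n : ℝ) + 1)) • (z : EuclideanSpace ℝ (Fin k)) +
      (1 / ((n : ℝ) + 1)) • (-((1 / 2 : ℝ) • w)), hconv z.2 hmem (by linarith [ht1 n])
        (ht n).le (by ring)⟩, fun n => ?_, ?_⟩
    · rw [Ne, label_eq_label_iff]
      simp only [hx, iff_true, mem_halfSpace, not_le]
      simp only [inner_add_right, inner_smul_right, inner_neg_right, hz,
        real_inner_self_eq_norm_sq, hw]
      have := ht n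
      nlinarith
    · rw [tendsto_subtype_rng]
      have h0 : Tendsto (fun n : ℕ => 1 / ((n : ℝ) + 1)) atTop (𝓝 0) :=
        tendsto_one_div_add_atTop_nhds_zero_nat
      have := ((h0.const_sub 1).smul_const (z : EuclideanSpace ℝ (Fin k))).add
        (h0.smul_const (-((1 / 2 : ℝ) • w)))
      simpa using this
  · refine ⟨fun _ => z, fun _ => ?_, tendsto_const_nhds⟩
    rw [Ne, label_eq_label_iff]
    simp [hx, mem_halfSpace, hz]

theorem inner_mul_inner_nonpos_of_mem_oppositeLimits {x z : Ball k}
    (hz : z ∈ oppositeLimits (halfSpace w) x) :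
    inner ℝ w (x : EuclideanSpace ℝ (Fin k)) * inner ℝ w (z : EuclideanSpace ℝ (Fin k)) ≤ 0 := by
  obtain ⟨u, hu, hlim⟩ := hz
  have hc : Continuous fun y : Ball k => inner ℝ w (x : EuclideanSpace ℝ (Fin k)) *
      inner ℝ w (y : EuclideanSpace ℝ (Fin k)) := by fun_prop
  refine le_of_tendsto ((hc.tendsto z).comp hlim) (Eventually.of_forall fun n => ?_)
  have := hu n
  rw [Ne, label_eq_label_iff, mem_halfSpace, mem_halfSpace] at this
  simp only [Function.comp]
  by_cases h : 0 ≤ inner ℝ w (x : EuclideanSpace ℝ (Fin k))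
  · simp only [h, iff_true, not_le] at this
    exact mul_nonpos_of_nonneg_of_nonpos h this.le
  · simp only [h, iff_false, not_not] at this
    exact mul_nonpos_of_nonpos_of_nonneg (not_le.1 h).le this

theorem CEmin_halfSpace (hw : ‖w‖ = 1) (x : Ball k) :
    CEmin (halfSpace w) x = {boundaryProj hw x} := by
  have hopp : boundaryProj hw x ∈ oppositeLimits (halfSpace w) x :=
    mem_oppositeLimits_of_inner_eq_zero hw x (inner_boundaryProj hw x)
  set a := inner ℝ w (x : EuclideanSpace ℝ (Fin k)) with ha
  -- Pythagoras with an obtuse angle at the projection: the defect is `2 * a * ⟪w, z⟫`, which is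
  -- nonpositive. This gives minimality and uniqueness together.
  have key : ∀ z ∈ oppositeLimits (halfSpace w) x,
      dist z (boundaryProj hw x) ^ 2 ≤ dist x z ^ 2 - dist x (boundaryProj hw x) ^ 2 := by
    intro z hz
    have h1 := inner_mul_inner_nonpos_of_mem_oppositeLimits hz
    have h2 : dist z (boundaryProj hw x) =
        ‖((x : EuclideanSpace ℝ (Fin k)) - z) - a • w‖ := by
      rw [dist_comm, Subtype.dist_eq, dist_eq_norm]
      congr 1
      simp only [boundaryProj]
      abel
    rw [h2, norm_sub_inner_smul_sq hw, inner_sub_right, dist_boundaryProj, sq_abs,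
      Subtype.dist_eq, dist_eq_norm]
    nlinarith
  ext z
  constructor
  · rintro ⟨hz, hmin⟩
    have h1 := key z hz
    have h2 : dist x z ^ 2 ≤ dist x (boundaryProj hw x) ^ 2 := by
      gcongr
      exact hmin _ hopp
    have h3 : dist z (boundaryProj hw x) ^ 2 = 0 := le_antisymm (by linarith) (sq_nonneg _)
    exact dist_eq_zero.1 (pow_eq_zero_iff two_ne_zero |>.1 h3)
  · rintro rfl
    refine ⟨hopp, fun y hy => ?_⟩
    have h1 := key y hy
    rw [← sq_le_sq₀ dist_nonneg dist_nonneg]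
    nlinarith [sq_nonneg (dist y (boundaryProj hw x))]

/-- A boundary point is its own ideal example, so zero noise would concentrate the answer at `x`,
which has the wrong label. -/
theorem CEprob_eq_empty_of_inner_eq_zero (hw : ‖w‖ = 1) {f : ℝ≥0 → ℝ≥0} (hf0 : f 0 = 0)
    {x : Ball k} (hx : inner ℝ w (x : EuclideanSpace ℝ (Fin k)) = 0) :
    CEprob f (halfSpace w) x = ∅ := by
  refine Set.eq_empty_of_forall_notMem ?_
  rintro ν ⟨hν, hl, z, hz, hint⟩
  rw [CEmin_halfSpace hw, Set.mem_singleton_iff] at hz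
  have hd : dist x z = 0 := by rw [hz, dist_boundaryProj, hx, abs_zero]
  obtain rfl := dist_eq_zero.1 hd
  rw [nndist_self, hf0, ENNReal.coe_zero, nonpos_iff_eq_zero,
    lintegral_eq_zero_iff (by fun_prop)] at hint
  obtain ⟨y, hy1, hy2⟩ := (hl.and hint).exists
  exact hy1 (by rw [edist_eq_zero.1 hy2])

/-- The displacement along the normal vector in a measurable choice of contrastive examples. -/
def contrastShift (f : ℝ≥0 → ℝ≥0) (a : ℝ) : ℝ :=
  if 0 < a then a + min (f a.toNNReal : ℝ) a else a

theorem measurable_contrastShift {f : ℝ≥0 → ℝ≥0} (hf : Monotone f) :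
    Measurable (contrastShift f) := by
  have := hf.measurable
  refine Measurable.ite measurableSet_Ioi ?_ measurable_id
  fun_prop

/-- A measurable choice of contrastive examples for the target `halfSpace w`. -/
def contrastPoint (f : ℝ≥0 → ℝ≥0) (hw : ‖w‖ = 1) (x : Ball k) : Ball k :=
  ⟨(x : EuclideanSpace ℝ (Fin k)) -
      contrastShift f (inner ℝ w (x : EuclideanSpace ℝ (Fin k))) • w,
    sub_smul_mem_ball hw x (by
      unfold contrastShift
      set a := inner ℝ w (x : EuclideanSpace ℝ (Fin k))
      -- A positive point must strictly cross the boundary, and capping the overshoot by `a` keeps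
      -- the shift below `2 * a`, hence inside the ball. Otherwise the projection already serves.
      split_ifs with h
      · have h1 : min (f a.toNNReal : ℝ) a ≤ a := min_le_right _ _
        have h2 : 0 ≤ min (f a.toNNReal : ℝ) a := le_min (by positivity) h.le
        nlinarith
      · nlinarith)⟩

theorem measurable_contrastPoint {f : ℝ≥0 → ℝ≥0} (hf : Monotone f) (hw : ‖w‖ = 1) :
    Measurable (contrastPoint f hw) := by
  have := measurable_contrastShift hf
  refine Measurable.subtype_mk ?_
  fun_prop

theorem contrastPoint_mem_CEapp {f : ℝ≥0 → ℝ≥0} (hpos : ∀ x, 0 < x → 0 < f x)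
    (hw : ‖w‖ = 1) {x : Ball k} (hx : inner ℝ w (x : EuclideanSpace ℝ (Fin k)) ≠ 0) :
    contrastPoint f hw x ∈ CEapp f (halfSpace w) x := by
  have hin : inner ℝ w (contrastPoint f hw x : EuclideanSpace ℝ (Fin k)) =
      inner ℝ w (x : EuclideanSpace ℝ (Fin k)) -
        contrastShift f (inner ℝ w (x : EuclideanSpace ℝ (Fin k))) := by
    simp [contrastPoint, inner_sub_right, inner_smul_right, hw]
  have hdist : dist (contrastPoint f hw x) (boundaryProj hw x) =
      |contrastShift f (inner ℝ w (x : EuclideanSpace ℝ (Fin k))) -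
        inner ℝ w (x : EuclideanSpace ℝ (Fin k))| := by
    rw [dist_comm, Subtype.dist_eq, dist_eq_norm]
    simp only [contrastPoint, boundaryProj]
    rw [sub_sub_sub_cancel_left, ← sub_smul, norm_smul, hw, mul_one, Real.norm_eq_abs]
  have hd := dist_boundaryProj hw x
  refine ⟨⟨boundaryProj hw x, by rw [CEmin_halfSpace hw]; rfl, ?_⟩, ?_⟩
  · rw [← NNReal.coe_le_coe, coe_nndist, hdist]
    unfold contrastShift
    split_ifs with h
    · have : nndist x (boundaryProj hw x) =
          (inner ℝ w (x : EuclideanSpace ℝ (Fin k))).toNNReal := by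
        rw [← NNReal.coe_inj, coe_nndist, hd, Real.coe_toNNReal _ h.le, abs_of_pos h]
      rw [this, add_sub_cancel_left, abs_of_nonneg (le_min (by positivity) h.le)]
      exact min_le_left _ _
    · simp
  · rw [Ne, label_eq_label_iff, mem_halfSpace, mem_halfSpace, hin]
    unfold contrastShift
    split_ifs with h
    · have : 0 < min (f (inner ℝ w (x : EuclideanSpace ℝ (Fin k))).toNNReal : ℝ)
          (inner ℝ w (x : EuclideanSpace ℝ (Fin k))) :=
        lt_min (by exact_mod_cast hpos _ (by simpa using h)) h
      simp only [h.le, iff_true, not_le]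
      linarith
    · have : ¬ 0 ≤ inner ℝ w (x : EuclideanSpace ℝ (Fin k)) := fun h' =>
        h (lt_of_le_of_ne h' (Ne.symm hx))
      simp [this]

theorem exists_measurable_contrast {f : ℝ≥0 → ℝ≥0} (hf : Monotone f) (hf0 : f 0 = 0)
    (hpos : ∀ x, 0 < x → 0 < f x) {ℓ : Set (Ball k)} (hℓ : ℓ ∈ HHS k) :
    ∃ g : Ball k → Ball k, Measurable g ∧
      ∀ x, (CEprob f ℓ x).Nonempty → g x ∈ CEapp f ℓ x := by
  rcases mem_HHS_iff.1 hℓ with rfl | ⟨w, hw, rfl⟩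
  · exact ⟨id, measurable_id, fun x hx => by simp [CEprob_univ] at hx⟩
  · refine ⟨contrastPoint f hw, measurable_contrastPoint hf hw, fun x hx => ?_⟩
    refine contrastPoint_mem_CEapp hpos hw fun h => ?_
    simp [CEprob_eq_empty_of_inner_eq_zero hw hf0 h] at hx

theorem appOracles_nonempty {f : ℝ≥0 → ℝ≥0} (hf : Monotone f) (hf0 : f 0 = 0)
    (hpos : ∀ x, 0 < x → 0 < f x) {ℓ : Set (Ball k)} (hℓ : ℓ ∈ HHS k) :
    (appOracles f ℓ).Nonempty := by
  obtain ⟨g, hg, H⟩ := exists_measurable_contrast hf hf0 hpos hℓ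
  refine ⟨⟨fun n => Kernel.deterministic (fun p => g p.2) (hg.comp measurable_snd),
    fun n => inferInstance⟩, fun n p => g p.2, fun n => hg.comp measurable_snd, ?_, ?_⟩
  · rintro n h x ⟨y, hy⟩
    exact H x ⟨_, dirac_mem_CEprob hy⟩
  · intro n p
    exact Kernel.deterministic_apply (hg.comp measurable_snd) p

theorem probOracles_nonempty {f : ℝ≥0 → ℝ≥0} (hf : Monotone f) (hf0 : f 0 = 0)
    (hpos : ∀ x, 0 < x → 0 < f x) {ℓ : Set (Ball k)} (hℓ : ℓ ∈ HHS k) :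
    (probOracles f ℓ).Nonempty := by
  obtain ⟨g, hg, H⟩ := exists_measurable_contrast hf hf0 hpos hℓ
  refine ⟨⟨fun n => Kernel.deterministic (fun p => g p.2) (hg.comp measurable_snd),
    fun n => inferInstance⟩, Kernel.deterministic g hg, ?_, ?_⟩
  · intro x hx
    rw [Kernel.deterministic_apply]
    exact dirac_mem_CEprob (H x hx)
  · intro n p
    simp [Kernel.deterministic_apply]

/-- In the first step, both models answer a query off the decision boundary by a distribution
that the probabilistic model allows. -/
theorem resp_zero_mem_CEprob {f : ℝ≥0 → ℝ≥0} (hpos : ∀ x, 0 < x → 0 < f x) (hw : ‖w‖ = 1)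
    {O : Oracle (Ball k)} (hO : O ∈ appOracles f (halfSpace w) ∪ probOracles f (halfSpace w))
    (h : Fin 0 → ExamplePair (Ball k)) {x : Ball k}
    (hx : inner ℝ w (x : EuclideanSpace ℝ (Fin k)) ≠ 0) :
    O.resp 0 (h, x) ∈ CEprob f (halfSpace w) x := by
  have hne := contrastPoint_mem_CEapp hpos hw hx
  rcases hO with ⟨g, -, hg, hO⟩ | ⟨D, hD, hO⟩
  · rw [hO]
    exact dirac_mem_CEprob (hg 0 h x ⟨_, hne⟩)
  · rw [hO]
    exact hD x ⟨_, dirac_mem_CEprob hne⟩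

end Geometry

/-! ### Errors of half-spaces under the uniform distribution. -/

section UniformDistribution

variable {k : ℕ}

theorem volume_ball_univ : (volume : Measure (Ball k)) Set.univ =
    volume (Metric.closedBall (0 : EuclideanSpace ℝ (Fin k)) (1 / 2)) := by
  rw [← volume_image_subtype_coe measurableSet_closedBall, Set.image_univ, Subtype.range_coe]

theorem uniform_setOf (P : EuclideanSpace ℝ (Fin k) → Prop) :
    uniform (Ball k) {x | P x} =
      (volume (Metric.closedBall (0 : EuclideanSpace ℝ (Fin k)) (1 / 2)))⁻¹ *
        volume (Metric.closedBall (0 : EuclideanSpace ℝ (Fin k)) (1 / 2) ∩ {x | P x}) := by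
  rw [uniform, cond_apply MeasurableSet.univ, Set.univ_inter, volume_ball_univ]
  congr 1
  rw [← volume_image_subtype_coe measurableSet_closedBall]
  congr 1
  ext x
  simp [and_comm]

instance : IsProbabilityMeasure (uniform (Ball k)) := by
  refine cond_isProbabilityMeasure_of_finite ?_ ?_
  · rw [volume_ball_univ]
    exact (Metric.measure_closedBall_pos _ _ (by norm_num)).ne'
  · rw [volume_ball_univ]
    exact measure_closedBall_lt_top.ne

theorem uniform_comp_isometry (e : EuclideanSpace ℝ (Fin k) ≃ₗᵢ[ℝ] EuclideanSpace ℝ (Fin k))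
    (P : EuclideanSpace ℝ (Fin k) → Prop) :
    uniform (Ball k) {x | P (e x)} = uniform (Ball k) {x | P x} := by
  rw [uniform_setOf fun x => P (e x), uniform_setOf P]
  congr 1
  rw [← (e.measurePreserving).measure_preimage_emb e.toHomeomorph.measurableEmbedding
    (Metric.closedBall 0 (1 / 2) ∩ {x | P x})]
  congr 1
  ext x
  simp

theorem uniform_hyperplane {w : EuclideanSpace ℝ (Fin k)} (hw : w ≠ 0) :
    uniform (Ball k) {x : Ball k | inner ℝ w (x : EuclideanSpace ℝ (Fin k)) = 0} = 0 := by
  have h0 : volume ((ℝ ∙ w)ᗮ : Set (EuclideanSpace ℝ (Fin k))) = 0 := by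
    refine Measure.addHaar_submodule _ _ fun h => hw ?_
    have : w ∈ (ℝ ∙ w)ᗮ := h ▸ Submodule.mem_top
    rwa [Submodule.mem_orthogonal_singleton_iff_inner_right, inner_self_eq_zero] at this
  refine (uniform_setOf fun x => inner ℝ w x = 0).trans (mul_eq_zero.2 ?_)
  refine .inr (measure_mono_null (fun x hx => ?_) h0)
  exact (Submodule.mem_orthogonal_singleton_iff_inner_right).2 hx.2

theorem ae_inner_ne_zero {w : EuclideanSpace ℝ (Fin k)} (hw : w ≠ 0) :
    ∀ᵐ x : Ball k ∂uniform (Ball k), inner ℝ w (x : EuclideanSpace ℝ (Fin k)) ≠ 0 := by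
  rw [ae_iff]
  simpa using uniform_hyperplane hw

/-- The map `x ↦ -x` preserves the measure and exchanges the two sides up to the null hyperplane. -/
theorem uniform_halfSpace_compl {w : EuclideanSpace ℝ (Fin k)} (hw : w ≠ 0) :
    (uniform (Ball k)).real (halfSpace w)ᶜ = 1 / 2 := by
  have hsymm : uniform (Ball k) (halfSpace w)ᶜ = uniform (Ball k) (halfSpace w) := by
    have h1 := uniform_comp_isometry (LinearIsometryEquiv.neg ℝ)
      fun x : EuclideanSpace ℝ (Fin k) => 0 ≤ inner ℝ w x
    change _ = uniform (Ball k) (halfSpace w) at h1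
    rw [← h1]
    refine measure_congr ?_
    filter_upwards [ae_inner_ne_zero hw] with x hx
    refine propext ?_
    change ¬ (0 ≤ inner ℝ w (x : EuclideanSpace ℝ (Fin k))) ↔
      0 ≤ inner ℝ w (-(x : EuclideanSpace ℝ (Fin k)))
    rw [inner_neg_right, not_le, Left.nonneg_neg_iff]
    exact ⟨le_of_lt, fun h => lt_of_le_of_ne h hx⟩
  have h2 := probReal_add_probReal_compl (μ := uniform (Ball k)) (measurableSet_halfSpace w)
  have h3 : (uniform (Ball k)).real (halfSpace w)ᶜ = (uniform (Ball k)).real (halfSpace w) := by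
    rw [measureReal_def, measureReal_def, hsymm]
  linarith

/-- Thin slabs around hyperplanes have small probability, uniformly in the direction. -/
theorem exists_uniform_slab_le {ε : ℝ} (hε : 0 < ε) :
    ∃ t : ℝ, 0 < t ∧ ∀ w : EuclideanSpace ℝ (Fin k), ‖w‖ = 1 →
      (uniform (Ball k)).real {x | |inner ℝ w (x : EuclideanSpace ℝ (Fin k))| ≤ t} ≤ ε := by
  by_cases hne : ∃ w : EuclideanSpace ℝ (Fin k), ‖w‖ = 1
  swap
  · exact ⟨1, one_pos, fun w hw => absurd ⟨w, hw⟩ hne⟩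
  obtain ⟨w₀, hw₀⟩ := hne
  have hmeas : ∀ t : ℝ, MeasurableSet
      {x : Ball k | |inner ℝ w₀ (x : EuclideanSpace ℝ (Fin k))| ≤ t} := fun t =>
    measurableSet_le (by fun_prop) measurable_const
  have hlim := tendsto_measure_biInter_gt (μ := uniform (Ball k)) (a := (0 : ℝ))
    (s := fun t => {x : Ball k | |inner ℝ w₀ (x : EuclideanSpace ℝ (Fin k))| ≤ t})
    (fun t _ => (hmeas t).nullMeasurableSet) (fun i j _ hij x hx => le_trans hx hij)
    ⟨1, one_pos, measure_ne_top _ _⟩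
  have h0 : uniform (Ball k) (⋂ t > (0 : ℝ),
      {x : Ball k | |inner ℝ w₀ (x : EuclideanSpace ℝ (Fin k))| ≤ t}) = 0 := by
    refine measure_mono_null (fun x hx => ?_)
      (uniform_hyperplane (norm_ne_zero_iff.1 (hw₀ ▸ one_ne_zero)))
    simp only [Set.mem_iInter] at hx
    exact abs_nonpos_iff.1 (le_of_forall_gt_imp_ge_of_dense fun t ht => hx t ht)
  rw [h0] at hlim
  obtain ⟨t, ht, ht0⟩ := ((hlim.eventually
    (gt_mem_nhds (ENNReal.ofReal_pos.2 hε))).and self_mem_nhdsWithin).exists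
  refine ⟨t, ht0, fun w hw => ?_⟩
  -- This reflection sends `w` to `w₀`, so the width `t` found for one direction works for all.
  set e := Submodule.reflection (ℝ ∙ (w - w₀))ᗮ with he
  have hew : e w = w₀ := Submodule.reflection_sub (hw.trans hw₀.symm)
  have h1 := uniform_comp_isometry e fun x => |inner ℝ w₀ x| ≤ t
  simp only [← hew, LinearIsometryEquiv.inner_map_map] at h1
  rw [measureReal_def, h1, hew]
  exact ENNReal.toReal_le_of_le_ofReal hε.le ht.le

theorem err_self (ℓ : Set (Ball k)) : err ℓ ℓ = 0 := by
  simp [err]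

theorem err_univ_halfSpace {w : EuclideanSpace ℝ (Fin k)} (hw : w ≠ 0) :
    err Set.univ (halfSpace w) = 1 / 2 := by
  rw [← uniform_halfSpace_compl hw, err]
  congr 1
  ext x
  simp [label]

theorem err_comm (C ℓ : Set (Ball k)) : err C ℓ = err ℓ C := by
  simp only [err, ne_comm]

theorem one_le_err_add_err_neg (C : Set (Ball k)) {w : EuclideanSpace ℝ (Fin k)} (hw : w ≠ 0) :
    1 ≤ err C (halfSpace w) + err C (halfSpace (-w)) := by
  have h : (Set.univ : Set (Ball k)) ≤ᵐ[uniform (Ball k)]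
      ({x | label (halfSpace w) x ≠ label C x} ∪
        {x | label (halfSpace (-w)) x ≠ label C x} : Set (Ball k)) := by
    filter_upwards [ae_inner_ne_zero hw] with x hx _
    change label (halfSpace w) x ≠ label C x ∨ label (halfSpace (-w)) x ≠ label C x
    by_contra! hc
    have := hc.1.trans hc.2.symm
    rw [label_eq_label_iff, mem_halfSpace, mem_halfSpace, inner_neg_left,
      Left.nonneg_neg_iff] at this
    rcases le_total 0 (inner ℝ w (x : EuclideanSpace ℝ (Fin k))) with h | h
    · exact hx (le_antisymm (this.1 h) h)
    · exact hx (le_antisymm h (this.2 h))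
  calc (1 : ℝ) = (uniform (Ball k)).real Set.univ := by simp
    _ ≤ (uniform (Ball k)).real ({x | label (halfSpace w) x ≠ label C x} ∪
        {x | label (halfSpace (-w)) x ≠ label C x}) :=
      ENNReal.toReal_mono (measure_ne_top _ _) (measure_mono_ae h)
    _ ≤ _ := measureReal_union_le _ _

/-- If a vector differs from the multiple `d • w` of the unit normal vector `w` by at most `t * d`,
then its half-space has a small error. -/
theorem err_halfSpace_le {w v : EuclideanSpace ℝ (Fin k)} {d t ε : ℝ} (hd : 0 < d)
    (hv : ‖v - d • w‖ ≤ t * d) (ht : 0 < t)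
    (hslab : (uniform (Ball k)).real
      {x | |inner ℝ w (x : EuclideanSpace ℝ (Fin k))| ≤ t} ≤ ε) :
    err (halfSpace v) (halfSpace w) ≤ ε := by
  refine le_trans (measureReal_mono fun x hx => ?_) hslab
  rw [Set.mem_ofPred_eq, Ne, label_eq_label_iff, mem_halfSpace, mem_halfSpace] at hx
  change |inner ℝ w (x : EuclideanSpace ℝ (Fin k))| ≤ t
  -- Where the labels disagree, `⟪v, x⟫` and `d * ⟪w, x⟫` lie on opposite sides of 0, so their
  -- difference bounds `d * |⟪w, x⟫|`.
  have h1 : |inner ℝ (v - d • w) (x : EuclideanSpace ℝ (Fin k))| ≤ t * d := by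
    refine (abs_real_inner_le_norm _ _).trans ?_
    have := norm_ball_le x
    have := norm_nonneg (v - d • w)
    have := norm_nonneg (x : EuclideanSpace ℝ (Fin k))
    nlinarith
  rw [inner_sub_left, real_inner_smul_left, abs_le] at h1
  rw [← mul_le_mul_iff_left₀ hd]
  rw [← abs_of_pos hd, ← abs_mul, abs_of_pos hd, abs_le]
  by_cases h : 0 ≤ inner ℝ w (x : EuclideanSpace ℝ (Fin k))
  · simp only [h, true_iff, not_le] at hx
    have := mul_nonneg h hd.le
    constructor <;> nlinarith
  · simp only [h, false_iff, not_not] at hx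
    rw [not_le] at h
    have := mul_pos_of_neg_of_neg h (neg_lt_zero.2 hd)
    constructor <;> nlinarith

end UniformDistribution

/-! ### Failure before the first example. -/

section LowerBound

variable {k : ℕ}

/-- Sets that cover each point twice. -/
theorem two_thirds_le_of_cover {Ω : Type*} [MeasurableSpace Ω] (μ : Measure Ω)
    [IsProbabilityMeasure μ] {B : Fin 3 → Set Ω}
    (h : ∀ p, (p ∈ B 0 ∧ p ∈ B 1) ∨ (p ∈ B 0 ∧ p ∈ B 2) ∨ (p ∈ B 1 ∧ p ∈ B 2)) :
    ∃ i, ENNReal.ofReal (2 / 3) ≤ μ (B i) := by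
  by_contra! hc
  -- The sets may be non-measurable; their measurable hulls still cover every point twice, so the
  -- three measures add up to at least 2.
  have hreal : ∀ i, μ.real (toMeasurable μ (B i)) < 2 / 3 := fun i => by
    rw [measureReal_def, measure_toMeasurable]
    exact (ENNReal.lt_ofReal_iff_toReal_lt (measure_ne_top _ _)).1 (hc i)
  have hsub : ∀ i, B i ⊆ toMeasurable μ (B i) := fun i => subset_toMeasurable μ _
  generalize hT : (fun i => toMeasurable μ (B i)) = T at *
  have hT' : ∀ i, toMeasurable μ (B i) = T i := fun i => congrFun hT i
  have hm : ∀ i, MeasurableSet (T i) := fun i => hT' i ▸ measurableSet_toMeasurable μ _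
  simp only [hT'] at hreal hsub
  have h1 : T 0 ∪ T 1 = Set.univ := by
    ext p; have := @hsub 0 p; have := @hsub 1 p; have := h p; simp; tauto
  have h2 : (T 0 ∩ T 1) ∪ T 2 = Set.univ := by
    ext p; have := @hsub 0 p; have := @hsub 1 p; have := @hsub 2 p; have := h p; simp; tauto
  have h3 := measureReal_union_add_inter (μ := μ) (s := T 0) (hm 1)
  have h4 := measureReal_union_le (μ := μ) (T 0 ∩ T 1) (T 2)
  rw [h1] at h3
  rw [h2] at h4
  rw [probReal_univ] at h3 h4
  linarith [hreal 0, hreal 1, hreal 2]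

/-- The targets that are used for the lower bounds. -/
def hardTarget (w : EuclideanSpace ℝ (Fin k)) : Fin 3 → Set (Ball k) :=
  ![Set.univ, halfSpace w, halfSpace (-w)]

theorem hardTarget_mem (w : EuclideanSpace ℝ (Fin k)) (i : Fin 3) : hardTarget w i ∈ HHS k := by
  fin_cases i
  exacts [univ_mem_HHS, halfSpace_mem_HHS w, halfSpace_mem_HHS (-w)]

/-- The whole ball has error `1 / 2` against both half-spaces. A proper half-space has error `1 / 2`
against the whole ball, and its errors against the two opposite targets sum to at least 1. -/
theorem lt_err_hardTarget {w : EuclideanSpace ℝ (Fin k)} (hw : w ≠ 0) {ε : ℝ} (hε : ε < 1 / 2)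
    {C : Set (Ball k)} (hC : C ∈ HHS k) :
    (ε < err C (hardTarget w 0) ∧ ε < err C (hardTarget w 1)) ∨
      (ε < err C (hardTarget w 0) ∧ ε < err C (hardTarget w 2)) ∨
      (ε < err C (hardTarget w 1) ∧ ε < err C (hardTarget w 2)) := by
  change (ε < err C Set.univ ∧ ε < err C (halfSpace w)) ∨
      (ε < err C Set.univ ∧ ε < err C (halfSpace (-w))) ∨
      (ε < err C (halfSpace w) ∧ ε < err C (halfSpace (-w)))
  rcases mem_HHS_iff.1 hC with rfl | ⟨v, hv, rfl⟩
  · rw [err_univ_halfSpace hw, err_univ_halfSpace (neg_ne_zero.2 hw)]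
    exact .inr (.inr ⟨hε, hε⟩)
  · rw [err_comm _ Set.univ, err_univ_halfSpace (norm_ne_zero_iff.1 (hv ▸ one_ne_zero))]
    have := one_le_err_add_err_neg (halfSpace v) hw
    by_cases h : ε < err (halfSpace v) (halfSpace w)
    · exact .inl ⟨hε, h⟩
    · exact .inr (.inl ⟨hε, by linarith⟩)

theorem exists_ne_zero_vector (hk : 1 ≤ k) : ∃ w : EuclideanSpace ℝ (Fin k), w ≠ 0 :=
  ⟨EuclideanSpace.single ⟨0, hk⟩ 1, by simp⟩

theorem exists_not_succeeds_zero (hk : 1 ≤ k) (A : ActiveLearner (Ball k) (HHS k)) {ε δ : ℝ}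
    (hε : ε < 1 / 2) (hδ : δ ≤ 2 / 3) :
    ∃ ℓ ∈ HHS k, ∀ O, ¬ Succeeds A ℓ O ε δ 0 := by
  obtain ⟨w, hw⟩ := exists_ne_zero_vector hk
  have hprob : IsProbabilityMeasure
      (A.seedLaw.map fun s => ((s, Fin.elim0) : A.Seed × (Fin 0 → ExamplePair (Ball k)))) :=
    Measure.isProbabilityMeasure_map (by fun_prop)
  obtain ⟨i, hi⟩ := two_thirds_le_of_cover
    (A.seedLaw.map fun s => ((s, Fin.elim0) : A.Seed × (Fin 0 → ExamplePair (Ball k))))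
    (B := fun i => {p | ε < err (A.output 0 p) (hardTarget w i)})
    fun p => lt_err_hardTarget hw hε (A.output_mem 0 p)
  exact ⟨_, hardTarget_mem w i, fun O => not_lt.2 ((ENNReal.ofReal_le_ofReal hδ).trans hi)⟩

theorem exists_not_succeeds_zero_of_isDeterministic (hk : 1 ≤ k)
    {A : ActiveLearner (Ball k) (HHS k)} (hA : A.IsDeterministic) {ε δ : ℝ}
    (hε : ε < 1 / 2) (hδ : δ ≤ 1) :
    ∃ ℓ ∈ HHS k, ∀ O, ¬ Succeeds A ℓ O ε δ 0 := by
  obtain ⟨w, hw⟩ := exists_ne_zero_vector hk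
  have hsub : Subsingleton A.Seed := hA
  have hprob : IsProbabilityMeasure
      (A.seedLaw.map fun s => ((s, Fin.elim0) : A.Seed × (Fin 0 → ExamplePair (Ball k)))) :=
    Measure.isProbabilityMeasure_map (by fun_prop)
  obtain ⟨p₀⟩ := nonempty_of_isProbabilityMeasure
    (A.seedLaw.map fun s => ((s, Fin.elim0) : A.Seed × (Fin 0 → ExamplePair (Ball k))))
  have hfail : ∃ i, ε < err (A.output 0 p₀) (hardTarget w i) := by
    rcases lt_err_hardTarget hw hε (A.output_mem 0 p₀) with h | h | h
    exacts [⟨_, h.1⟩, ⟨_, h.1⟩, ⟨_, h.1⟩]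
  obtain ⟨i, hi⟩ := hfail
  refine ⟨_, hardTarget_mem w i, fun O => not_lt.2 ?_⟩
  have huniv : {p | ε < err (A.output 0 p) (hardTarget w i)} = Set.univ :=
    Set.eq_univ_of_forall fun p => by rwa [Subsingleton.elim p p₀]
  rw [huniv]
  change _ ≤ (A.seedLaw.map _) Set.univ
  rw [hprob.measure_univ]
  exact ENNReal.ofReal_le_one.2 hδ

theorem one_le_sampleComplexity {CE : Set (Ball k) → Set (Oracle (Ball k))}
    (hne : ∀ ℓ ∈ HHS k, (CE ℓ).Nonempty) {A : ActiveLearner (Ball k) (HHS k)} {ε δ : ℝ}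
    (h : ∃ ℓ ∈ HHS k, ∀ O, ¬ Succeeds A ℓ O ε δ 0) : 1 ≤ sampleComplexity CE A ε δ := by
  rw [Order.one_le_iff_ne_zero, Ne, sampleComplexity_eq_zero_iff]
  intro H
  obtain ⟨ℓ, hℓ, hO⟩ := h
  obtain ⟨O, hO'⟩ := hne ℓ hℓ
  exact hO O (H ℓ hℓ O hO' 0)

end LowerBound

/-! ### The learner that needs one example pair. -/

section UpperBound

variable {k : ℕ}

/-- The homothety of the ball with ratio `r`. -/
def shrink (r : Set.Icc (0 : ℝ) 1) (x : Ball k) : Ball k :=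
  ⟨(r : ℝ) • (x : EuclideanSpace ℝ (Fin k)), by
    rw [mem_closedBall_zero_iff, norm_smul, Real.norm_of_nonneg r.2.1]
    exact (mul_le_of_le_one_left (norm_nonneg _) r.2.2).trans (norm_ball_le x)⟩

/-- The difference of the positive and the negative example in a pair, or zero if the labels
agree. -/
def contrastVector (p : ExamplePair (Ball k)) : EuclideanSpace ℝ (Fin k) :=
  if p.2.2 = p.1.2 then 0
  else if p.1.2 then (p.1.1 : EuclideanSpace ℝ (Fin k)) - p.2.1
  else (p.2.1 : EuclideanSpace ℝ (Fin k)) - p.1.1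

/-- The learner that queries a random point near the origin and outputs the half-space whose
normal vector is given by the first example pair. -/
def contrastLearner (k : ℕ) (r : Set.Icc (0 : ℝ) 1) : ActiveLearner (Ball k) (HHS k) where
  Seed := Ball k
  seedLaw := uniform (Ball k)
  isProbabilityMeasure_seedLaw := inferInstance
  query _ p := shrink r p.1
  measurable_query _ := by
    refine Measurable.subtype_mk ?_
    fun_prop
  output
    | 0, _ => Set.univ
    | _ + 1, p => halfSpace (contrastVector (p.2 0))
  output_mem n _ := by
    cases n
    exacts [univ_mem_HHS, halfSpace_mem_HHS _]

variable {w : EuclideanSpace ℝ (Fin k)}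

/-- The example pairs whose contrastive example is close to the ideal one. -/
def informativePairs (hw : ‖w‖ = 1) (t : ℝ) : Set (ExamplePair (Ball k)) :=
  {p | p.1.2 = label (halfSpace w) p.1.1 ∧ p.2.2 ≠ p.1.2 ∧
    inner ℝ w (p.1.1 : EuclideanSpace ℝ (Fin k)) ≠ 0 ∧
    dist p.2.1 (boundaryProj hw p.1.1) ≤ t * |inner ℝ w (p.1.1 : EuclideanSpace ℝ (Fin k))|}

theorem measurableSet_informativePairs (hw : ‖w‖ = 1) (t : ℝ) :
    MeasurableSet (informativePairs hw t) := by
  have hl := measurable_label (measurableSet_halfSpace w)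
  have hb : Measurable (boundaryProj hw) := Measurable.subtype_mk (by fun_prop)
  have hi : Measurable fun p : ExamplePair (Ball k) =>
    inner ℝ w (p.1.1 : EuclideanSpace ℝ (Fin k)) := by fun_prop
  have h1 : MeasurableSet {p : ExamplePair (Ball k) | p.1.2 = label (halfSpace w) p.1.1} :=
    measurableSet_eq_fun (by fun_prop) (by fun_prop)
  have h2 : MeasurableSet {p : ExamplePair (Ball k) | p.2.2 = p.1.2} :=
    measurableSet_eq_fun (by fun_prop) (by fun_prop)
  have h3 : MeasurableSet {p : ExamplePair (Ball k) | dist p.2.1 (boundaryProj hw p.1.1) ≤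
      t * |inner ℝ w (p.1.1 : EuclideanSpace ℝ (Fin k))|} :=
    measurableSet_le (by fun_prop) (by fun_prop)
  exact h1.inter (h2.compl.inter
    ((measurableSet_eq_fun hi measurable_const).compl.inter h3))

/-- With an exact answer the contrast vector would be `|⟪w, x⟫| • w`, for either label of `x`; its
deviation from this has the norm of the answer's deviation from the projection. -/
theorem err_contrastVector_le (hw : ‖w‖ = 1) {t ε : ℝ} (ht : 0 < t)
    (hslab : (uniform (Ball k)).real
      {x | |inner ℝ w (x : EuclideanSpace ℝ (Fin k))| ≤ t} ≤ ε)
    {p : ExamplePair (Ball k)} (hp : p ∈ informativePairs hw t) :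
    err (halfSpace (contrastVector p)) (halfSpace w) ≤ ε := by
  obtain ⟨hl, hne, h0, hd⟩ := hp
  refine err_halfSpace_le (abs_pos.2 h0) (le_trans (le_of_eq ?_) hd) ht hslab
  rw [Subtype.dist_eq, dist_eq_norm, contrastVector, if_neg hne]
  simp only [boundaryProj]
  by_cases h : p.1.1 ∈ halfSpace w
  · rw [if_pos (hl.trans (label_eq_true_iff.2 h)), abs_of_nonneg (mem_halfSpace.1 h), ← norm_neg]
    congr 1
    abel
  · rw [if_neg (by rwa [hl, label_eq_true_iff]), abs_of_neg (not_le.1 h)]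
    congr 1
    rw [neg_smul]
    abel

/-- Markov's inequality for the distance to the ideal contrastive example. -/
theorem measure_far_le {f : ℝ≥0 → ℝ≥0} {c : ℝ} (hc : 0 < c) (hfc : ∀ x, f x ≤ x ^ (1 + c))
    (hw : ‖w‖ = 1) {x : Ball k} {r t : ℝ} (ht : 0 < t)
    (hx : inner ℝ w (x : EuclideanSpace ℝ (Fin k)) ≠ 0)
    (hr : |inner ℝ w (x : EuclideanSpace ℝ (Fin k))| ≤ r)
    {ν : Measure (Ball k)} (hν : ν ∈ CEprob f (halfSpace w) x) :
    ν {y | t * |inner ℝ w (x : EuclideanSpace ℝ (Fin k))| < dist y (boundaryProj hw x)} ≤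
      ENNReal.ofReal (r ^ c / t) := by
  obtain ⟨-, -, z, hz, hint⟩ := hν
  rw [CEmin_halfSpace hw, Set.mem_singleton_iff] at hz
  subst hz
  have hd : 0 < |inner ℝ w (x : EuclideanSpace ℝ (Fin k))| := abs_pos.2 hx
  have hnn : (nndist x (boundaryProj hw x) : ℝ) =
      |inner ℝ w (x : EuclideanSpace ℝ (Fin k))| := dist_boundaryProj hw x
  set d := |inner ℝ w (x : EuclideanSpace ℝ (Fin k))|
  have hf : (f (nndist x (boundaryProj hw x)) : ℝ) ≤ d * r ^ c := by
    calc (f (nndist x (boundaryProj hw x)) : ℝ)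
        ≤ ((nndist x (boundaryProj hw x) ^ (1 + c) : ℝ≥0) : ℝ) := by exact_mod_cast hfc _
      -- The factor `d` split off here cancels against the Markov threshold `t * d`, leaving a bound
      -- uniform in the query.
      _ = d * d ^ c := by rw [NNReal.coe_rpow, hnn, Real.rpow_add hd, Real.rpow_one]
      _ ≤ d * r ^ c := by gcongr
  have htd : 0 < t * d := mul_pos ht hd
  calc ν {y | t * d < dist y (boundaryProj hw x)}
      ≤ ν {y | ENNReal.ofReal (t * d) ≤ edist y (boundaryProj hw x)} := by
        refine measure_mono fun y hy => ?_
        change _ ≤ edist _ _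
        rw [edist_dist]
        exact ENNReal.ofReal_le_ofReal (le_of_lt hy)
    _ ≤ (∫⁻ y, edist y (boundaryProj hw x) ∂ν) / ENNReal.ofReal (t * d) :=
        meas_ge_le_lintegral_div (by fun_prop) (ENNReal.ofReal_pos.2 htd).ne' ENNReal.ofReal_ne_top
    _ ≤ ENNReal.ofReal (d * r ^ c) / ENNReal.ofReal (t * d) := by
        gcongr
        refine hint.trans ?_
        rw [← ENNReal.ofReal_coe_nnreal]
        exact ENNReal.ofReal_le_ofReal hf
    _ = ENNReal.ofReal (r ^ c / t) := by
        rw [← ENNReal.ofReal_div_of_pos htd, mul_comm t d, mul_div_mul_left _ _ hd.ne']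

theorem succeeds_contrastLearner_univ (r : Set.Icc (0 : ℝ) 1) (O : Oracle (Ball k)) {ε δ : ℝ}
    (hε : 0 < ε) (hδ : 0 < δ) (m : ℕ) :
    Succeeds (contrastLearner k r) Set.univ O ε δ (m + 1) := by
  have hS : MeasurableSet {p : (contrastLearner k r).Seed × ExamplePair (Ball k) |
      p.2.2.2 = p.2.1.2}ᶜ :=
    (measurableSet_eq_fun (by fun_prop) (by fun_prop)).compl
  refine lt_of_le_of_lt ((measure_mono fun p hp => ?_).trans
    (interactionLaw_first_le (contrastLearner k r) MeasurableSet.univ O m hS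
      (Eventually.of_forall fun s => ?_))) (ENNReal.ofReal_pos.2 hδ)
  · intro h
    change ε < err (halfSpace (contrastVector (p.2 0))) Set.univ at hp
    have h' : (p.2 0).2.2 = (p.2 0).1.2 := h
    rw [contrastVector, if_pos h', halfSpace_zero, err_self] at hp
    exact absurd hp hε.not_gt
  · refine (measure_mono_null (fun y hy => ?_) measure_empty).le
    refine absurd ?_ hy
    change label Set.univ y = label Set.univ _
    simp [label]

theorem succeeds_contrastLearner_halfSpace {f : ℝ≥0 → ℝ≥0} (hpos : ∀ x, 0 < x → 0 < f x)
    {c : ℝ} (hc : 0 < c) (hfc : ∀ x, f x ≤ x ^ (1 + c)) (hw : ‖w‖ = 1)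
    {r : Set.Icc (0 : ℝ) 1} (hr : 0 < (r : ℝ)) {t ε δ : ℝ} (ht : 0 < t)
    (hslab : (uniform (Ball k)).real
      {x | |inner ℝ w (x : EuclideanSpace ℝ (Fin k))| ≤ t} ≤ ε)
    (hδ : 0 < δ) (hrt : (r : ℝ) ^ c / t < δ) {O : Oracle (Ball k)}
    (hO : O ∈ appOracles f (halfSpace w) ∪ probOracles f (halfSpace w)) (m : ℕ) :
    Succeeds (contrastLearner k r) (halfSpace w) O ε δ (m + 1) := by
  have hS : MeasurableSet ((fun p : (contrastLearner k r).Seed × ExamplePair (Ball k) => p.2) ⁻¹'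
      (informativePairs hw t)ᶜ) :=
    measurable_snd (measurableSet_informativePairs hw t).compl
  have hae : ∀ᵐ s ∂(contrastLearner k r).seedLaw,
      inner ℝ w ((show Ball k from s) : EuclideanSpace ℝ (Fin k)) ≠ 0 :=
    ae_inner_ne_zero (norm_ne_zero_iff.1 (hw ▸ one_ne_zero))
  refine lt_of_le_of_lt ((measure_mono fun p hp => ?_).trans
    (interactionLaw_first_le (contrastLearner k r) (measurableSet_halfSpace w) O m hS
      (η := ENNReal.ofReal ((r : ℝ) ^ c / t)) ?_)) ((ENNReal.ofReal_lt_ofReal_iff hδ).2 hrt)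
  · intro h
    exact absurd (err_contrastVector_le hw ht hslab h) (not_le.2 hp)
  · filter_upwards [hae] with s hs
    change O.resp 0 (Fin.elim0, shrink r s) {y | ((shrink r s, label (halfSpace w) (shrink r s)),
      (y, label (halfSpace w) y)) ∉ informativePairs hw t} ≤ _
    have hin : inner ℝ w (shrink r s : EuclideanSpace ℝ (Fin k)) =
        r * inner ℝ w ((show Ball k from s) : EuclideanSpace ℝ (Fin k)) :=
      real_inner_smul_right _ _ _
    have hne : inner ℝ w (shrink r s : EuclideanSpace ℝ (Fin k)) ≠ 0 :=
      hin ▸ mul_ne_zero hr.ne' hs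
    have hle : |inner ℝ w (shrink r s : EuclideanSpace ℝ (Fin k))| ≤ r := by
      rw [hin, abs_mul, abs_of_pos hr]
      refine mul_le_of_le_one_right hr.le ((abs_real_inner_le_norm _ _).trans ?_)
      rw [hw, one_mul]
      exact (norm_ball_le _).trans (by norm_num)
    have hmem := resp_zero_mem_CEprob hpos hw hO Fin.elim0 hne
    refine le_trans (measure_mono_ae ?_) (measure_far_le hc hfc hw ht hne hle hmem)
    filter_upwards [hmem.2.1] with y hy hbad
    by_contra hnot
    exact hbad ⟨rfl, hy, hne, not_lt.1 hnot⟩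

theorem exists_learner_succeeds_succ {f : ℝ≥0 → ℝ≥0} (hpos : ∀ x, 0 < x → 0 < f x)
    {c : ℝ} (hc : 0 < c) (hfc : ∀ x, f x ≤ x ^ (1 + c)) {ε δ : ℝ} (hε : 0 < ε) (hδ : 0 < δ) :
    ∃ A : ActiveLearner (Ball k) (HHS k), ∀ ℓ ∈ HHS k, ∀ O ∈ appOracles f ℓ ∪ probOracles f ℓ,
      ∀ m, Succeeds A ℓ O ε δ (m + 1) := by
  obtain ⟨t, ht, hslab⟩ := exists_uniform_slab_le (k := k) hε
  have htδ : 0 < t * δ / 2 := by positivity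
  -- The radius is chosen so that `r ^ c ≤ t * δ / 2`, the half making the failure bound strict; the
  -- cap 1 makes it a valid ratio for `shrink`.
  have hr : 0 < min 1 ((t * δ / 2) ^ c⁻¹) := lt_min one_pos (Real.rpow_pos_of_pos htδ _)
  have hrt : min 1 ((t * δ / 2) ^ c⁻¹) ^ c / t < δ := by
    rw [div_lt_iff₀ ht]
    calc min 1 ((t * δ / 2) ^ c⁻¹) ^ c ≤ ((t * δ / 2) ^ c⁻¹) ^ c := by
          gcongr
          exact min_le_right _ _
      _ = t * δ / 2 := Real.rpow_inv_rpow htδ.le hc.ne'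
      _ < δ * t := by nlinarith
  refine ⟨contrastLearner k ⟨_, hr.le, min_le_left _ _⟩, fun ℓ hℓ O hO m => ?_⟩
  rcases mem_HHS_iff.1 hℓ with rfl | ⟨w, hw, rfl⟩
  · exact succeeds_contrastLearner_univ _ O hε hδ m
  · exact succeeds_contrastLearner_halfSpace hpos hc hfc hw hr ht (hslab w hw) hδ hrt hO m

end UpperBound

end ContrastiveLearning

end

open ContrastiveLearning in
theorem corollary1 (k : ℕ) (hk : 1 ≤ k) (f : ℝ≥0 → ℝ≥0) (hf : Monotone f)
    (hpos : ∀ x, 0 < x → 0 < f x) (c : ℝ) (hc : 0 < c) (hfc : ∀ x, f x ≤ x ^ (1 + c))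
    (ε δ : ℝ) (hε : 0 < ε) (hε' : ε ≤ 1) (hδ : 0 < δ) (hδ' : δ ≤ 1) :
    activeSampleComplexity (HHS k) (appOracles f) ε δ =
        activeSampleComplexity (HHS k) (probOracles f) ε δ ∧
      activeSampleComplexity (HHS k) (probOracles f) ε δ ≤ 1 ∧
      (ε < 1 / 2 → δ ≤ 2 / 3 → activeSampleComplexity (HHS k) (probOracles f) ε δ = 1) ∧
      (ε < 1 / 2 → ∀ A : ActiveLearner (Ball k) (HHS k), A.IsDeterministic →
        1 ≤ sampleComplexity (appOracles f) A ε δ ∧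
          1 ≤ sampleComplexity (probOracles f) A ε δ) := by
  have hf0 : f 0 = 0 := by
    have := hfc 0
    rwa [NNReal.zero_rpow (by positivity), nonpos_iff_eq_zero] at this
  have happ : ∀ ℓ ∈ HHS k, (appOracles f ℓ).Nonempty := fun _ => appOracles_nonempty hf hf0 hpos
  have hprob : ∀ ℓ ∈ HHS k, (probOracles f ℓ).Nonempty := fun _ =>
    probOracles_nonempty hf hf0 hpos
  obtain ⟨A, hA⟩ := exists_learner_succeeds_succ (k := k) hpos hc hfc hε hδ
  have h1 : activeSampleComplexity (HHS k) (appOracles f) ε δ ≤ 1 :=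
    iInf_le_of_le A (sampleComplexity_le_one fun ℓ hℓ O hO => hA ℓ hℓ O (.inl hO))
  have h2 : activeSampleComplexity (HHS k) (probOracles f) ε δ ≤ 1 :=
    iInf_le_of_le A (sampleComplexity_le_one fun ℓ hℓ O hO => hA ℓ hℓ O (.inr hO))
  have hmeas : ∀ ℓ ∈ HHS k, MeasurableSet ℓ := fun _ => measurableSet_of_mem_HHS
  have hiff : activeSampleComplexity (HHS k) (appOracles f) ε δ = 0 ↔
      activeSampleComplexity (HHS k) (probOracles f) ε δ = 0 := by
    rw [activeSampleComplexity_eq_zero_iff hmeas happ,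
      activeSampleComplexity_eq_zero_iff hmeas hprob]
  refine ⟨?_, h2, fun hε2 hδ2 => le_antisymm h2 (le_iInf fun B =>
    one_le_sampleComplexity hprob (exists_not_succeeds_zero hk B hε2 hδ2)), fun hε2 B hB =>
    have hB' := exists_not_succeeds_zero_of_isDeterministic hk hB hε2 hδ'
    ⟨one_le_sampleComplexity happ hB', one_le_sampleComplexity hprob hB'⟩⟩
  -- Both values are at most 1 and they vanish together, so they are equal.
  by_cases h : activeSampleComplexity (HHS k) (appOracles f) ε δ = 0
  · rw [h, hiff.1 h]
  · rw [le_antisymm h1 (Order.one_le_iff_ne_zero.2 h),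
      le_antisymm h2 (Order.one_le_iff_ne_zero.2 fun h' => h (hiff.2 h'))]
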